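/- Let $(X_t)_{t\ge 0}$ be a real-valued Lévy process on a probability space $(\Omega,\mathcal F,P)$ with characteristic triplet $(\bar b,\sigma,\nu)$, where $\bar b\in\mathbb R$, $\sigma\ge 0$ and $\nu$ is a $\sigma$-finite Borel measure on $\mathbb R$ with $\int \frac{x^2}{1+x^2}\,\nu(dx)<\infty$; that is, for all $t\ge0$ and $u\in\mathbb R$, $$E\big[e^{iuX_t}\big]=\exp\Big(t\Big(iu\bar b-\tfrac{\sigma^2}{2}u^2+\int_{\mathbb R}\big(e^{iux}-1-\tfrac{iux}{1+x^2}\big)\,\nu(dx)\Big)\Big).$$ Let $\mathcal M(\mathbb R)$ be the set of all finite Borel measures on $\mathbb R$. For $b\in\mathbb R$ and $\mu\in\mathcal M(\mathbb R)$ put $$\phi(u;b,\mu)=\exp\Big(iub+\int_{\mathbb R}\frac{(e^{iux}-1)(1+x^2)-iux}{x^2}\,\mu(dx)\Big),\qquad u\in\mathbb R,$$ where the integrand is extended continuously to $x=0$ by the value $-u^2/2$. Put $$\bar\nu_\sigma(dx)=\sigma^2\,\delta_0(dx)+\frac{x^2}{1+x^2}\,\nu(dx)\in\mathcal M(\mathbb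 R),\qquad \widehat\phi_n(u)=\frac1n\sum_{k=1}^n e^{iu(X_k-X_{k-1})}\quad(n\ge 1).$$ Let $d$ be a distance on the set of characteristic functions of Borel probability measures on $\mathbb R$: $d$ takes values in $[0,\infty]$, is symmetric, satisfies $d(\phi,\phi)=0$ and the triangle inequality (any metric is allowed; neither finiteness nor separation of points is required). Assume that 1. $\lim_{n\to\infty} d\big(\widehat\phi_n,\phi(\cdot;\bar b,\bar\nu_\sigma)\big)=0$ $P$-almost surely; 2. for all sequences $(b_n)$ in $\mathbb R$ and $(\mu_n)$ in $\mathcal M(\mathbb R)$: if $d\big(\phi(\cdot;b_n,\mu_n),\phi(\cdot;\bar b,\bar\nu_\sigma)\big)\to0$, then $\int_s^t\phi(u;b_n,\mu_n)\,du\to\int_s^t\phi(u;\bar b,\bar\nu_\sigma)\,du$ for all $s,t\in\mathbb R$. Let $(\delta_n)_{n\ge1}$ be positive reals with $\delta_n\to0$, and let $\widehat b_n$ (with values in $\mathbb R$) and $\widehat\nu_{\sigma,n}$ (with values in $\mathcal M(\mathbb R)$) be functions on $\Omega$ such that, $P$-almost surely, for all $n\ge1$, $$d\big(\widehat\phi_n,\phi(\cdot;\widehat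 b_n,\widehat\nu_{\sigma,n})\big)\le\inf_{\tilde b\in\mathbb R,\ \tilde\nu\in\mathcal M(\mathbb R)}d\big(\widehat\phi_n,\phi(\cdot;\tilde b,\tilde\nu)\big)+\delta_n .$$ Then $P$-almost surely, as $n\to\infty$, $\widehat b_n\to\bar b$ and $\widehat\nu_{\sigma,n}$ converges weakly to $\bar\nu_\sigma$. -/

import Mathlib

open MeasureTheory ProbabilityTheory Filter Topology
open scoped NNReal ENNReal

/-- `ν` is a jump measure: a `σ`-finite Borel measure on `ℝ` with `∫ x²/(1+x²) ν(dx) < ∞`.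
A possible atom at `0` is irrelevant: it contributes neither to the characteristic exponent nor to
the measure `x²/(1+x²) ν(dx)`. -/
structure IsJumpMeasure (ν : Measure ℝ) : Prop where
  sigmaFinite : SigmaFinite ν
  lintegral_lt_top : ∫⁻ x, ENNReal.ofReal (x ^ 2 / (1 + x ^ 2)) ∂ν < ∞

/-- The characteristic exponent of the triplet `(b, σ, ν)`:
`Ψ(u) = iub - σ²u²/2 + ∫ (e^{iux} - 1 - iux/(1+x²)) ν(dx)`. -/
noncomputable def tripletExponent (b σ : ℝ) (ν : Measure ℝ) (u : ℝ) : ℂ :=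
  Complex.I * u * b - (σ : ℂ) ^ 2 / 2 * (u : ℂ) ^ 2 +
    ∫ x : ℝ, (Complex.exp (Complex.I * u * x) - 1 - Complex.I * u * x / (1 + (x : ℂ) ^ 2)) ∂ν

/-- The finite Borel measure `ν_σ(dx) = σ² δ₀(dx) + x²/(1+x²) ν(dx)`. -/
noncomputable def nuSigma (σ : ℝ) (ν : Measure ℝ) (hν : IsJumpMeasure ν) : FiniteMeasure ℝ :=
  ⟨ENNReal.ofReal (σ ^ 2) • Measure.dirac 0 +
      ν.withDensity (fun x => ENNReal.ofReal (x ^ 2 / (1 + x ^ 2))), by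
    have h1 : IsFiniteMeasure (ν.withDensity (fun x => ENNReal.ofReal (x ^ 2 / (1 + x ^ 2)))) :=
      isFiniteMeasure_withDensity hν.lintegral_lt_top.ne
    have h2 : IsFiniteMeasure (ENNReal.ofReal (σ ^ 2) • Measure.dirac (0 : ℝ)) :=
      Measure.smul_finite _ ENNReal.ofReal_ne_top
    infer_instance⟩

/-- The kernel `((e^{iux} - 1)(1+x²) - iux)/x²`, with its continuous extension `-u²/2` at `x = 0`. -/
noncomputable def levyKernel (u x : ℝ) : ℂ :=
  if x = 0 then -((u : ℂ) ^ 2 / 2)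
  else ((Complex.exp (Complex.I * u * x) - 1) * (1 + (x : ℂ) ^ 2) - Complex.I * u * x) /
    (x : ℂ) ^ 2

/-- The characteristic function `φ(u; b, μ) = exp (iub + ∫ ((e^{iux} - 1)(1+x²) - iux)/x² μ(dx))`
for `b ∈ ℝ` and a finite Borel measure `μ` on `ℝ`. -/
noncomputable def levyPhi (b : ℝ) (μ : FiniteMeasure ℝ) (u : ℝ) : ℂ :=
  Complex.exp (Complex.I * u * b + ∫ x, levyKernel u x ∂(μ : Measure ℝ))

/-- `X` is a (one-dimensional) Lévy process under `P`: it starts at `0`, has independent and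
stationary increments, and is stochastically continuous. (No path regularity is required; in
particular every Lévy process with càdlàg paths is covered.) -/
structure IsLevyProcess {Ω : Type*} [MeasurableSpace Ω] (P : Measure Ω) (X : ℝ≥0 → Ω → ℝ) :
    Prop where
  aemeasurable : ∀ t, AEMeasurable (X t) P
  start : ∀ᵐ ω ∂P, X 0 ω = 0
  indepIncrements : HasIndepIncrements X P
  stationaryIncrements : ∀ s t : ℝ≥0,
    P.map (fun ω => X (s + t) ω - X s ω) = P.map (X t)
  stochContinuous : ∀ t : ℝ≥0, TendstoInMeasure P X (𝓝 t) (X t)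

/-- The Lévy process `X` has characteristic triplet `(b, σ, ν)`:
`E[exp(iuX_t)] = exp(t Ψ(u; b, σ, ν))` for all `t ≥ 0` and `u ∈ ℝ`. -/
def HasTriplet {Ω : Type*} [MeasurableSpace Ω] (P : Measure Ω) (X : ℝ≥0 → Ω → ℝ)
    (b σ : ℝ) (ν : Measure ℝ) : Prop :=
  ∀ (t : ℝ≥0) (u : ℝ), ∫ ω, Complex.exp (Complex.I * u * X t ω) ∂P =
    Complex.exp ((t : ℝ) * tripletExponent b σ ν u)

/-- The empirical characteristic function of the increments over `[k, k+1]`, `k < n`: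
`n⁻¹ ∑_{k=1}^n e^{iu(X_k - X_{k-1})}`. It is only used for `n ≥ 1`. -/
noncomputable def empiricalCharFun {Ω : Type*} (X : ℝ≥0 → Ω → ℝ) (n : ℕ) (ω : Ω) (u : ℝ) : ℂ :=
  (1 / (n : ℂ)) * ∑ k ∈ Finset.range n,
    Complex.exp (Complex.I * u * ((X ((k : ℝ≥0) + 1) ω - X (k : ℝ≥0) ω : ℝ) : ℂ))

/-- The set of characteristic functions of Borel probability measures on `ℝ`. -/
def charFunctions : Set (ℝ → ℂ) :=
  {φ | ∃ μ : Measure ℝ, IsProbabilityMeasure μ ∧ φ = charFun μ}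

/-- `d` is a distance on the set `S`, possibly with the value `∞` and possibly vanishing on pairs of
distinct points. Every metric on `S` is of this form. -/
structure IsDistanceOn {α : Type*} (S : Set α) (d : α → α → ℝ≥0∞) : Prop where
  self : ∀ x ∈ S, d x x = 0
  symm : ∀ x ∈ S, ∀ y ∈ S, d x y = d y x
  triangle : ∀ x ∈ S, ∀ y ∈ S, ∀ z ∈ S, d x z ≤ d x y + d y z

/-!
Write `Ψ` for the exponent of `φ(·; b, μ)`. The difference `Ψ(u) - ½ ∫_{-1}^1 Ψ(u + s) ds` does not
depend on the drift `b`, and it is the Fourier transform of the finite measure `w μ` with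
`w(x) = (1 - sin x / x) (1 + x²) / x²`, a weight bounded above and bounded away from `0`.

Approximate minimality and the triangle inequality show that the fitted characteristic functions
converge in `d` to the true one, so their integrals over intervals converge. This forces tightness,
hence equicontinuity and locally uniform convergence, which passes to the exponents because a
continuous logarithm normalised at `0` is unique. Lévy's continuity theorem, applied to the averaged
exponents, gives weak convergence of `w μₙ`, hence of `μₙ`; the drift is then read off from `Ψ(1)`.
-/

/-! ### The Lévy kernel -/

/-- The entire function `(e^{iy} - 1 - iy) / y²` on the real line, written as the remainder integral
of Taylor's formula so that it is visibly continuous at `0` and bounded. It is the singular part of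
`levyKernel`. -/
noncomputable def expRemainderQuotient (y : ℝ) : ℂ :=
  -∫ t in (0 : ℝ)..1, (1 - (t : ℂ)) * Complex.exp (Complex.I * t * y)

lemma sq_mul_expRemainderQuotient (y : ℝ) :
    (y : ℂ) ^ 2 * expRemainderQuotient y = Complex.exp (Complex.I * y) - 1 - Complex.I * y := by
  rcases eq_or_ne y 0 with rfl | hy
  · simp
  have hy' : (y : ℂ) ≠ 0 := by exact_mod_cast hy
  have hderiv (t : ℝ) : HasDerivAt
      (fun t : ℝ => (1 - (t : ℂ)) * (Complex.exp (Complex.I * t * y) / (Complex.I * y))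
        + Complex.exp (Complex.I * t * y) / (Complex.I * y) ^ 2)
      ((1 - (t : ℂ)) * Complex.exp (Complex.I * t * y)) t := by
    have hid : HasDerivAt (fun t : ℝ => (t : ℂ)) 1 t := Complex.ofRealCLM.hasDerivAt
    have hexp : HasDerivAt (fun t : ℝ => Complex.exp (Complex.I * t * y))
        (Complex.exp (Complex.I * t * y) * (Complex.I * 1 * y)) t :=
      ((hid.const_mul Complex.I).mul_const (y : ℂ)).cexp
    convert! ((hid.const_sub 1).mul (hexp.div_const (Complex.I * y))).add
      (hexp.div_const ((Complex.I * y) ^ 2)) using 1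
    field_simp
    ring
  rw [expRemainderQuotient, intervalIntegral.integral_eq_sub_of_hasDerivAt (fun t _ => hderiv t)
    (Continuous.intervalIntegrable (by fun_prop) _ _)]
  simp only [Complex.ofReal_one, Complex.ofReal_zero, mul_zero, zero_mul, Complex.exp_zero,
    mul_one, mul_pow, Complex.I_sq]
  field_simp
  linear_combination (y : ℂ) * Complex.I_sq

lemma continuous_expRemainderQuotient : Continuous expRemainderQuotient := by
  unfold expRemainderQuotient
  refine (intervalIntegral.continuous_parametric_intervalIntegral_of_continuous' ?_ 0 1).neg
  fun_prop

lemma expRemainderQuotient_zero : expRemainderQuotient 0 = -(1 / 2) := by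
  have hint : ∫ t in (0 : ℝ)..1, (1 - t) = 1 / 2 := by
    rw [intervalIntegral.integral_sub (by simp) (by simp)]; norm_num
  have hcast : ∫ t in (0 : ℝ)..1, (1 - (t : ℂ)) = ((∫ t in (0 : ℝ)..1, (1 - t) : ℝ) : ℂ) := by
    rw [← intervalIntegral.integral_ofReal]; simp
  simp [expRemainderQuotient, hcast, hint]

lemma norm_cexp_I_mul_mul (u x : ℝ) : ‖Complex.exp (Complex.I * u * x)‖ = 1 := by
  rw [mul_assoc, ← Complex.ofReal_mul, Complex.norm_exp_I_mul_ofReal]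

lemma norm_expRemainderQuotient_le (y : ℝ) : ‖expRemainderQuotient y‖ ≤ 1 := by
  rw [expRemainderQuotient, norm_neg]
  refine (intervalIntegral.norm_integral_le_of_norm_le_const (C := 1) fun t ht => ?_).trans
    (by simp)
  rw [Set.uIoc_of_le zero_le_one] at ht
  rw [norm_mul, norm_cexp_I_mul_mul, mul_one, ← Complex.ofReal_one, ← Complex.ofReal_sub,
    Complex.norm_real, Real.norm_eq_abs, abs_le]
  constructor <;> linarith [ht.1, ht.2]

lemma levyKernel_of_ne_zero (u : ℝ) {x : ℝ} (hx : x ≠ 0) :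
    levyKernel u x = (1 + (x : ℂ)⁻¹ ^ 2) * (Complex.exp (Complex.I * u * x) - 1) -
      Complex.I * u * (x : ℂ)⁻¹ := by
  have hx' : (x : ℂ) ≠ 0 := by exact_mod_cast hx
  rw [levyKernel, if_neg hx]
  field_simp
  ring

lemma levyKernel_eq (u x : ℝ) :
    levyKernel u x = (u : ℂ) ^ 2 * expRemainderQuotient (u * x) +
      (Complex.exp (Complex.I * u * x) - 1) := by
  rcases eq_or_ne x 0 with rfl | hx
  · simp [levyKernel, expRemainderQuotient_zero]; ring
  have hx' : (x : ℂ) ≠ 0 := by exact_mod_cast hx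
  have hquot : (u : ℂ) ^ 2 * expRemainderQuotient (u * x) =
      (Complex.exp (Complex.I * u * x) - 1 - Complex.I * u * x) / (x : ℂ) ^ 2 := by
    have h := sq_mul_expRemainderQuotient (u * x)
    push_cast at h
    rw [eq_div_iff (pow_ne_zero 2 hx'), mul_assoc Complex.I, ← h]; ring
  rw [hquot, levyKernel, if_neg hx]
  field_simp
  ring

lemma continuous_uncurry_levyKernel : Continuous (Function.uncurry levyKernel) := by
  have hfun : Function.uncurry levyKernel = fun p : ℝ × ℝ =>
      (p.1 : ℂ) ^ 2 * expRemainderQuotient (p.1 * p.2) +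
        (Complex.exp (Complex.I * p.1 * p.2) - 1) := funext fun p => levyKernel_eq p.1 p.2
  have := continuous_expRemainderQuotient
  rw [hfun]
  fun_prop

lemma continuous_levyKernel_left (x : ℝ) : Continuous fun u => levyKernel u x :=
  continuous_uncurry_levyKernel.comp (Continuous.prodMk_left x)

lemma continuous_levyKernel_right (u : ℝ) : Continuous (levyKernel u) :=
  continuous_uncurry_levyKernel.comp (Continuous.prodMk_right u)

lemma norm_levyKernel_le (u x : ℝ) : ‖levyKernel u x‖ ≤ u ^ 2 + 2 := by
  rw [levyKernel_eq]
  refine (norm_add_le _ _).trans (add_le_add ?_ ?_)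
  · rw [norm_mul, norm_pow, Complex.norm_real, Real.norm_eq_abs, sq_abs]
    exact mul_le_of_le_one_right (sq_nonneg u) (norm_expRemainderQuotient_le _)
  · refine (norm_sub_le _ _).trans ?_
    rw [norm_cexp_I_mul_mul, norm_one]; norm_num

lemma integrable_levyKernel (u : ℝ) (μ : Measure ℝ) [IsFiniteMeasure μ] :
    Integrable (levyKernel u) μ :=
  .of_bound (continuous_levyKernel_right u).aestronglyMeasurable (u ^ 2 + 2)
    (.of_forall (norm_levyKernel_le u))

lemma continuous_integral_levyKernel (μ : Measure ℝ) [IsFiniteMeasure μ] :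
    Continuous fun u => ∫ x, levyKernel u x ∂μ := by
  refine continuous_iff_continuousAt.2 fun u₀ => ?_
  refine continuousAt_of_dominated (bound := fun _ => (u₀ ^ 2 + 1) + 2)
    (.of_forall fun u => (continuous_levyKernel_right u).aestronglyMeasurable) ?_
    (integrable_const _) (.of_forall fun x => (continuous_levyKernel_left x).continuousAt)
  have hsq : ∀ᶠ u in 𝓝 u₀, u ^ 2 < u₀ ^ 2 + 1 :=
    ((continuous_pow 2).tendsto u₀).eventually_lt_const (lt_add_one _)
  filter_upwards [hsq] with u hu
  exact .of_forall fun x => (norm_levyKernel_le u x).trans (by gcongr)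

lemma intervalIntegral_integral_levyKernel_swap (μ : Measure ℝ) [IsFiniteMeasure μ] (u a b : ℝ) :
    ∫ s in a..b, ∫ x, levyKernel (u + s) x ∂μ = ∫ x, (∫ s in a..b, levyKernel (u + s) x) ∂μ := by
  have hbound : IntervalIntegrable (fun s : ℝ => (u + s) ^ 2 + 2) volume a b :=
    Continuous.intervalIntegrable (by fun_prop) _ _
  have hcont : Continuous fun p : ℝ × ℝ => levyKernel (u + p.1) p.2 :=
    continuous_uncurry_levyKernel.comp (by fun_prop : Continuous fun p : ℝ × ℝ => (u + p.1, p.2))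
  exact intervalIntegral_integral_swap (f := fun s x => levyKernel (u + s) x) <|
    (hbound.def'.comp_fst μ).mono' hcont.aestronglyMeasurable
      (.of_forall fun p => norm_levyKernel_le (u + p.1) p.2)

/-- The exponent `iub + ∫ ((e^{iux} - 1)(1+x²) - iux)/x² μ(dx)` of `levyPhi b μ`. -/
noncomputable def levyExponent (b : ℝ) (μ : FiniteMeasure ℝ) (u : ℝ) : ℂ :=
  Complex.I * u * b + ∫ x, levyKernel u x ∂(μ : Measure ℝ)

lemma levyExponent_zero (b : ℝ) (μ : FiniteMeasure ℝ) : levyExponent b μ 0 = 0 := by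
  simp [levyExponent, levyKernel_eq]

lemma continuous_levyExponent (b : ℝ) (μ : FiniteMeasure ℝ) : Continuous (levyExponent b μ) := by
  unfold levyExponent
  have := continuous_integral_levyKernel (μ : Measure ℝ)
  fun_prop

/-! ### Averaging the exponent -/

lemma intervalIntegral_cexp_I_mul_mul (x : ℝ) :
    ∫ s in (-1 : ℝ)..1, Complex.exp (Complex.I * s * x) = 2 * Real.sinc x := by
  rcases eq_or_ne x 0 with rfl | hx
  · simp; norm_num
  have hx' : (x : ℂ) ≠ 0 := by exact_mod_cast hx
  have hcomm (s : ℝ) : Complex.exp (Complex.I * s * x) = Complex.exp ((s * x : ℝ) * Complex.I) := by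
    push_cast; ring_nf
  simp_rw [hcomm]
  rw [intervalIntegral.integral_comp_mul_right
    (fun t : ℝ => Complex.exp (t * Complex.I)) hx, neg_one_mul, one_mul,
    integral_exp_mul_I_eq_sinc, Complex.real_smul]
  push_cast
  field_simp

lemma intervalIntegral_neg_self_ofReal (a : ℝ) : ∫ s in -a..a, (s : ℂ) = 0 := by
  rw [intervalIntegral.integral_ofReal]; simp

/-- The weight `w` for which `Ψ(u) - ½ ∫_{-1}^1 Ψ(u + s) ds` is the Fourier transform of `w μ`,
where `Ψ` is the exponent of `levyPhi b μ`. The value at `0` is the continuous extension. -/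
noncomputable def levyWeight (x : ℝ) : ℝ :=
  if x = 0 then 1 / 6 else (1 + x⁻¹ ^ 2) * (1 - Real.sinc x)

lemma average_levyKernel_of_ne_zero (u : ℝ) {x : ℝ} (hx : x ≠ 0) :
    (1 / 2) * ∫ s in (-1 : ℝ)..1, levyKernel (u + s) x =
      (1 + (x : ℂ)⁻¹ ^ 2) * (Complex.exp (Complex.I * u * x) * Real.sinc x - 1) -
        Complex.I * u * (x : ℂ)⁻¹ := by
  have hshift (s : ℝ) : levyKernel (u + s) x =
      (1 + (x : ℂ)⁻¹ ^ 2) * Complex.exp (Complex.I * u * x) *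
        Complex.exp (Complex.I * s * x) -
      (1 + (x : ℂ)⁻¹ ^ 2 + Complex.I * u * (x : ℂ)⁻¹) -
      Complex.I * (x : ℂ)⁻¹ * s := by
    have hexp : Complex.exp (Complex.I * (u + s : ℝ) * x) =
        Complex.exp (Complex.I * u * x) * Complex.exp (Complex.I * s * x) := by
      rw [← Complex.exp_add]; push_cast; ring_nf
    rw [levyKernel_of_ne_zero _ hx, hexp]
    push_cast
    ring
  simp_rw [hshift]
  rw [intervalIntegral.integral_sub (Continuous.intervalIntegrable (by fun_prop) _ _)
      (Continuous.intervalIntegrable (by fun_prop) _ _),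
    intervalIntegral.integral_sub (Continuous.intervalIntegrable (by fun_prop) _ _)
      (Continuous.intervalIntegrable (by fun_prop) _ _),
    intervalIntegral.integral_const_mul, intervalIntegral.integral_const_mul,
    intervalIntegral.integral_const, intervalIntegral_cexp_I_mul_mul,
    intervalIntegral_neg_self_ofReal, Complex.real_smul]
  push_cast
  ring

lemma levyKernel_sub_average (u x : ℝ) :
    levyKernel u x - (1 / 2) * ∫ s in (-1 : ℝ)..1, levyKernel (u + s) x =
      Complex.exp (Complex.I * u * x) * levyWeight x := by
  rcases eq_or_ne x 0 with rfl | hx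
  · have hzero (s : ℝ) : levyKernel (u + s) 0 = ((-((u + s) ^ 2 / 2) : ℝ) : ℂ) := by
      simp [levyKernel]
    simp_rw [hzero]
    rw [intervalIntegral.integral_ofReal]
    simp [levyKernel, levyWeight, intervalIntegral.integral_comp_add_left (fun s => s ^ 2)]
    ring
  · rw [average_levyKernel_of_ne_zero u hx, levyKernel_of_ne_zero u hx, levyWeight, if_neg hx]
    push_cast
    ring

lemma ofReal_levyWeight (x : ℝ) :
    (levyWeight x : ℂ) = -(1 / 2) * ∫ s in (-1 : ℝ)..1, levyKernel s x := by
  simpa [levyKernel_eq 0] using (levyKernel_sub_average 0 x).symm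

lemma continuous_levyWeight : Continuous levyWeight := by
  have hfun : levyWeight = fun x => (-(1 / 2) * ∫ s in (-1 : ℝ)..1, levyKernel s x).re :=
    funext fun x => by rw [← ofReal_levyWeight, Complex.ofReal_re]
  have hint : Continuous fun x => ∫ s in (-1 : ℝ)..1, levyKernel s x :=
    intervalIntegral.continuous_parametric_intervalIntegral_of_continuous'
      (f := fun x s => levyKernel s x) (continuous_uncurry_levyKernel.comp continuous_swap) _ _
  rw [hfun]
  fun_prop

lemma levyWeight_pos (x : ℝ) : 0 < levyWeight x := by
  rw [levyWeight]
  split_ifs with hx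
  · norm_num
  have hsinc : Real.sinc x < 1 := by
    rw [Real.sinc_of_ne_zero hx]
    rcases lt_or_gt_of_ne hx with h | h
    · rw [div_lt_one_of_neg h]
      linarith [Real.sin_lt (neg_pos.2 h), Real.sin_neg x]
    · exact (div_lt_one h).2 (Real.sin_lt h)
  have := sub_pos.2 hsinc
  positivity

lemma half_le_levyWeight {x : ℝ} (hx : 2 ≤ |x|) : 1 / 2 ≤ levyWeight x := by
  have hx0 : x ≠ 0 := abs_pos.1 (by linarith)
  have hsinc : Real.sinc x ≤ 1 / 2 := (Real.sinc_le_inv_abs hx0).trans <| by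
    rw [one_div]; exact inv_anti₀ two_pos hx
  rw [levyWeight, if_neg hx0]
  nlinarith [sq_nonneg x⁻¹]

lemma exists_pos_le_levyWeight : ∃ c > 0, ∀ x, c ≤ levyWeight x := by
  obtain ⟨y, -, hy⟩ := isCompact_Icc.exists_isMinOn (s := Set.Icc (-2 : ℝ) 2) ⟨0, by simp⟩
    continuous_levyWeight.continuousOn
  refine ⟨min (levyWeight y) (1 / 2), lt_min (levyWeight_pos y) (by norm_num), fun x => ?_⟩
  rcases le_total |x| 2 with hx | hx
  · exact (min_le_left _ _).trans (hy (abs_le.1 hx))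
  · exact (min_le_right _ _).trans (half_le_levyWeight hx)

lemma levyWeight_le (x : ℝ) : levyWeight x ≤ 3 := by
  have hint : ‖∫ s in (-1 : ℝ)..1, levyKernel s x‖ ≤ 3 * |1 - (-1)| := by
    refine intervalIntegral.norm_integral_le_of_norm_le_const fun s hs => ?_
    rw [Set.uIoc_of_le (by norm_num)] at hs
    exact (norm_levyKernel_le s x).trans (by nlinarith [hs.1, hs.2])
  calc levyWeight x ≤ ‖(levyWeight x : ℂ)‖ := by
        rw [Complex.norm_real]; exact Real.le_norm_self _
    _ = 1 / 2 * ‖∫ s in (-1 : ℝ)..1, levyKernel s x‖ := by rw [ofReal_levyWeight]; simp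
    _ ≤ 3 := by norm_num at hint ⊢; linarith

lemma integrable_cexp_mul_levyWeight (u : ℝ) (μ : Measure ℝ) [IsFiniteMeasure μ] :
    Integrable (fun x : ℝ => Complex.exp (Complex.I * u * x) * levyWeight x) μ := by
  have := continuous_levyWeight
  refine .of_bound (Continuous.aestronglyMeasurable (by fun_prop)) 3 (.of_forall fun x => ?_)
  rw [norm_mul, norm_cexp_I_mul_mul, one_mul, Complex.norm_real, Real.norm_eq_abs,
    abs_of_pos (levyWeight_pos x)]
  exact levyWeight_le x

lemma average_integral_levyKernel (μ : Measure ℝ) [IsFiniteMeasure μ] (u : ℝ) :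
    (1 / 2) * ∫ s in (-1 : ℝ)..1, ∫ x, levyKernel (u + s) x ∂μ =
      ∫ x, levyKernel u x ∂μ - ∫ x, Complex.exp (Complex.I * u * x) * levyWeight x ∂μ := by
  rw [intervalIntegral_integral_levyKernel_swap, ← integral_const_mul,
    ← integral_sub (integrable_levyKernel u μ) (integrable_cexp_mul_levyWeight u μ)]
  congr 1 with x
  rw [← levyKernel_sub_average, sub_sub_cancel]

lemma average_drift (b u : ℝ) :
    (1 / 2) * ∫ s in (-1 : ℝ)..1, Complex.I * (u + s : ℝ) * b = Complex.I * u * b := by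
  have hsplit (s : ℝ) : Complex.I * (u + s : ℝ) * b =
      Complex.I * u * b + Complex.I * b * s := by push_cast; ring
  simp_rw [hsplit]
  rw [intervalIntegral.integral_add (by simp) (Continuous.intervalIntegrable (by fun_prop) _ _),
    intervalIntegral.integral_const_mul (Complex.I * b), intervalIntegral_neg_self_ofReal]
  simp
  ring

lemma levyExponent_sub_average (b : ℝ) (μ : FiniteMeasure ℝ) (u : ℝ) :
    levyExponent b μ u - (1 / 2) * ∫ s in (-1 : ℝ)..1, levyExponent b μ (u + s) =
      ∫ x, Complex.exp (Complex.I * u * x) * levyWeight x ∂(μ : Measure ℝ) := by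
  have hcont : Continuous fun s : ℝ => ∫ x, levyKernel (u + s) x ∂(μ : Measure ℝ) :=
    (continuous_integral_levyKernel _).comp (continuous_const_add u)
  simp only [levyExponent]
  rw [intervalIntegral.integral_add (Continuous.intervalIntegrable (by fun_prop) _ _)
    (hcont.intervalIntegrable _ _), mul_add, average_drift, average_integral_levyKernel]
  ring

/-! ### Infinitely divisible characteristic functions -/

lemma charFun_eq_integral_cexp (μ : Measure ℝ) (u : ℝ) :
    charFun μ u = ∫ x : ℝ, Complex.exp (Complex.I * u * x) ∂μ := by
  rw [charFun_apply_real]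
  congr 1 with x
  congr 1
  ring

lemma integrable_cexp_I_mul_mul (u : ℝ) (μ : Measure ℝ) [IsFiniteMeasure μ] :
    Integrable (fun x : ℝ => Complex.exp (Complex.I * u * x)) μ :=
  .of_bound (Continuous.aestronglyMeasurable (by fun_prop)) 1
    (.of_forall fun x => (norm_cexp_I_mul_mul u x).le)

lemma mul_mem_charFunctions {f g : ℝ → ℂ} (hf : f ∈ charFunctions) (hg : g ∈ charFunctions) :
    (fun u => f u * g u) ∈ charFunctions := by
  obtain ⟨μ, hμ, rfl⟩ := hf
  obtain ⟨ν, hν, rfl⟩ := hg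
  exact ⟨μ ∗ ν, inferInstance, funext fun u => (charFun_conv u).symm⟩

lemma exp_drift_mem_charFunctions (b : ℝ) :
    (fun u : ℝ => Complex.exp (Complex.I * u * b)) ∈ charFunctions :=
  ⟨Measure.dirac b, inferInstance, funext fun u => by
    rw [charFun_eq_integral_cexp, integral_dirac]⟩

lemma one_mem_charFunctions : (fun _ => 1) ∈ charFunctions := by
  simpa using exp_drift_mem_charFunctions 0

lemma exp_gaussian_mem_charFunctions (v : ℝ≥0) :
    (fun u : ℝ => Complex.exp (-(v * u ^ 2 / 2))) ∈ charFunctions :=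
  ⟨gaussianReal 0 v, inferInstance, funext fun u => by simp [charFun_gaussianReal]⟩

lemma pow_mem_charFunctions {f : ℝ → ℂ} (hf : f ∈ charFunctions) (n : ℕ) :
    (fun u => f u ^ n) ∈ charFunctions := by
  induction n with
  | zero => simpa only [pow_zero] using one_mem_charFunctions
  | succ n ih => simpa only [pow_succ] using mul_mem_charFunctions ih hf

lemma convex_charFunctions : Convex ℝ charFunctions := by
  rintro _ ⟨μ, hμ, rfl⟩ _ ⟨ν, hν, rfl⟩ a b ha hb hab
  have := Measure.smul_finite μ (c := ENNReal.ofReal a) ENNReal.ofReal_ne_top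
  have := Measure.smul_finite ν (c := ENNReal.ofReal b) ENNReal.ofReal_ne_top
  refine ⟨ENNReal.ofReal a • μ + ENNReal.ofReal b • ν, ⟨?_⟩, funext fun u => ?_⟩
  · simp [← ENNReal.ofReal_add ha hb, hab]
  · rw [charFun_eq_integral_cexp, integral_add_measure (integrable_cexp_I_mul_mul u _)
      (integrable_cexp_I_mul_mul u _), integral_smul_measure, integral_smul_measure,
      ← charFun_eq_integral_cexp, ← charFun_eq_integral_cexp, ENNReal.toReal_ofReal ha,
      ENNReal.toReal_ofReal hb]
    rfl

lemma mem_charFunctions_of_tendsto {f : ℕ → ℝ → ℂ} {g : ℝ → ℂ}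
    (hf : ∀ᶠ n in atTop, f n ∈ charFunctions) (hg : ContinuousAt g 0)
    (hfg : ∀ u, Tendsto (fun n => f n u) atTop (𝓝 (g u))) : g ∈ charFunctions := by
  obtain ⟨N, hN⟩ := eventually_atTop.1 hf
  choose μ hμ hμf using fun n => hN (n + N) (Nat.le_add_left N n)
  have hlim (u : ℝ) : Tendsto (fun n => charFun (μ n) u) atTop (𝓝 (g u)) := by
    simpa only [hμf] using (tendsto_add_atTop_iff_nat N).2 (hfg u)
  let Q : ℕ → ProbabilityMeasure ℝ := fun n => ⟨μ n, hμ n⟩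
  have htight : IsTightMeasureSet (Set.range μ) := isTightMeasureSet_of_tendsto_charFun hg hlim
  have hcompact : IsCompact (closure (Set.range Q)) := by
    refine isCompact_closure_of_isTightMeasureSet (htight.subset ?_)
    rintro _ ⟨_, ⟨n, rfl⟩, rfl⟩
    exact ⟨n, rfl⟩
  obtain ⟨Q₀, -, hQ₀⟩ := hcompact.exists_mapClusterPt (f := atTop) (u := Q)
    (tendsto_principal.2 (.of_forall fun n => subset_closure ⟨n, rfl⟩))
  obtain ⟨U, hU, hUQ⟩ := mapClusterPt_iff_ultrafilter.1 hQ₀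
  refine ⟨Q₀, inferInstance, funext fun u => tendsto_nhds_unique ((hlim u).mono_left hU) ?_⟩
  simp_rw [charFun_eq_integral_innerProbChar]
  exact (ProbabilityMeasure.tendsto_iff_forall_integral_rclike_tendsto ℂ).1 hUQ
    (BoundedContinuousFunction.innerProbChar u)

lemma exp_mul_sub_one_mem_charFunctions {f : ℝ → ℂ} (hf : f ∈ charFunctions) {r : ℝ}
    (hr : 0 ≤ r) : (fun u => Complex.exp (r * (f u - 1))) ∈ charFunctions := by
  have hcont : Continuous f := by
    obtain ⟨μ, hμ, rfl⟩ := hf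
    exact continuous_charFun
  refine mem_charFunctions_of_tendsto (f := fun n u => (1 + r * (f u - 1) / n) ^ n) ?_
    (by fun_prop) fun u => Complex.tendsto_one_add_div_pow_exp _
  filter_upwards [eventually_ge_atTop ⌈r⌉₊] with n hn
  have hrn : r / n ≤ 1 := div_le_one_of_le₀ (Nat.ceil_le.1 hn) n.cast_nonneg
  refine pow_mem_charFunctions (f := fun u => 1 + r * (f u - 1) / n) ?_ n
  convert! convex_charFunctions one_mem_charFunctions hf (sub_nonneg.2 hrn)
    (div_nonneg hr n.cast_nonneg) (sub_add_cancel 1 (r / n)) using 1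
  ext u
  simp only [Pi.add_apply, Pi.smul_apply, Complex.real_smul]
  push_cast
  ring

lemma exp_compoundPoisson_mem_charFunctions (m : Measure ℝ) [IsFiniteMeasure m] :
    (fun u : ℝ => Complex.exp (∫ x : ℝ, (Complex.exp (Complex.I * u * x) - 1) ∂m)) ∈
      charFunctions := by
  rcases eq_or_ne m 0 with rfl | hm
  · simpa using one_mem_charFunctions
  have : NeZero m := ⟨hm⟩
  have hmass : m.real Set.univ ≠ 0 := by simpa [measureReal_eq_zero_iff] using hm
  have hprob : charFun ((m Set.univ)⁻¹ • m) ∈ charFunctions := ⟨_, inferInstance, rfl⟩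
  convert! exp_mul_sub_one_mem_charFunctions hprob (measureReal_nonneg (μ := m) (s := Set.univ))
    using 3 with u
  rw [integral_sub (integrable_cexp_I_mul_mul u m) (integrable_const _), charFun_eq_integral_cexp,
    integral_smul_measure, ENNReal.toReal_inv, ← measureReal_def, mul_sub, Complex.real_smul,
    Complex.ofReal_inv, mul_inv_cancel_left₀ (by exact_mod_cast hmass)]
  simp

lemma exp_integral_levyKernel_mem_charFunctions {μ : Measure ℝ} [IsFiniteMeasure μ]
    (hμ : ∀ᵐ x ∂μ, x ≠ 0) (hinv : MemLp (fun x : ℝ => x⁻¹) 2 μ) :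
    (fun u : ℝ => Complex.exp (∫ x, levyKernel u x ∂μ)) ∈ charFunctions := by
  let w : ℝ → ℝ := fun x => 1 + x⁻¹ ^ 2
  have hw : Integrable w μ := (integrable_const 1).add hinv.integrable_sq
  let m : Measure ℝ := μ.withDensity fun x => ENNReal.ofReal (w x)
  have : IsFiniteMeasure m := isFiniteMeasure_withDensity_ofReal hw.2
  have hm (f : ℝ → ℂ) : ∫ x, f x ∂m = ∫ x, w x * f x ∂μ := by
    rw [integral_withDensity_eq_integral_toReal_smul (by fun_prop) (by simp)]
    congr 1 with x
    rw [ENNReal.toReal_ofReal (by positivity), Complex.real_smul]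
  have hexponent (u : ℝ) : ∫ x, levyKernel u x ∂μ =
      ∫ x : ℝ, (Complex.exp (Complex.I * u * x) - 1) ∂m +
        Complex.I * u * ((-∫ x, x⁻¹ ∂μ : ℝ) : ℂ) := by
    have hjump : (fun x => levyKernel u x + Complex.I * u * (x⁻¹ : ℝ)) =ᵐ[μ]
        fun x => w x * (Complex.exp (Complex.I * u * x) - 1) := by
      filter_upwards [hμ] with x hx
      rw [levyKernel_of_ne_zero u hx]
      push_cast [w]
      ring
    have hdrift : Integrable (fun x : ℝ => Complex.I * u * (x⁻¹ : ℝ)) μ :=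
      (hinv.integrable one_le_two).ofReal.const_mul _
    rw [hm, ← integral_congr_ae hjump, integral_add (integrable_levyKernel u μ) hdrift,
      integral_const_mul, integral_complex_ofReal]
    push_cast
    ring
  simp_rw [hexponent, Complex.exp_add]
  exact mul_mem_charFunctions (exp_compoundPoisson_mem_charFunctions m)
    (exp_drift_mem_charFunctions _)

lemma exp_setIntegral_levyKernel_mem_charFunctions (μ : Measure ℝ) [IsFiniteMeasure μ] {ε : ℝ}
    (hε : 0 < ε) :
    (fun u : ℝ => Complex.exp (∫ x in {x : ℝ | ε < |x|}, levyKernel u x ∂μ)) ∈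
      charFunctions := by
  have hmem : ∀ᵐ x ∂μ.restrict {x : ℝ | ε < |x|}, ε < |x| :=
    ae_restrict_mem (measurableSet_lt measurable_const continuous_abs.measurable)
  refine exp_integral_levyKernel_mem_charFunctions
    (hmem.mono fun x hx => abs_pos.1 (hε.trans hx))
    (.of_bound measurable_inv.aestronglyMeasurable ε⁻¹ (hmem.mono fun x hx => ?_))
  rw [norm_inv, Real.norm_eq_abs]
  exact inv_anti₀ hε hx.le

lemma tendsto_setIntegral_abs_gt {E : Type*} [NormedAddCommGroup E] [NormedSpace ℝ E]
    {μ : Measure ℝ} {f : ℝ → E} (hf : Integrable f μ) :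
    Tendsto (fun n : ℕ => ∫ x in {x : ℝ | 1 / ((n : ℝ) + 1) < |x|}, f x ∂μ) atTop
      (𝓝 (∫ x in {0}ᶜ, f x ∂μ)) := by
  have hunion : ({0}ᶜ : Set ℝ) = ⋃ n : ℕ, {x : ℝ | 1 / ((n : ℝ) + 1) < |x|} := by
    ext x
    simp only [Set.mem_compl_iff, Set.mem_singleton_iff, Set.mem_iUnion, Set.mem_ofPred_eq]
    refine ⟨fun hx => exists_nat_one_div_lt (abs_pos.2 hx), ?_⟩
    rintro ⟨n, hn⟩
    exact abs_pos.1 (Nat.one_div_pos_of_nat.trans hn)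
  have hmono : Monotone fun n : ℕ => {x : ℝ | 1 / ((n : ℝ) + 1) < |x|} := fun m n hmn =>
    Set.ofPred_subset_ofPred.2 fun x => (Nat.one_div_le_one_div hmn).trans_lt
  rw [hunion]
  exact tendsto_setIntegral_of_monotone
    (fun n => measurableSet_lt measurable_const continuous_abs.measurable) hmono hf.integrableOn

lemma integral_levyKernel_eq_add_setIntegral_compl (μ : FiniteMeasure ℝ) (u : ℝ) :
    ∫ x, levyKernel u x ∂(μ : Measure ℝ) =
      -((μ {0} : ℝ≥0) * u ^ 2 / 2) + ∫ x in {0}ᶜ, levyKernel u x ∂(μ : Measure ℝ) := by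
  have hatom : (μ : Measure ℝ).real {0} = (μ {0} : ℝ≥0) := rfl
  rw [← integral_add_compl (measurableSet_singleton 0) (integrable_levyKernel u _),
    integral_singleton, hatom, levyKernel, if_pos rfl, Complex.real_smul]
  ring

lemma levyPhi_mem_charFunctions (b : ℝ) (μ : FiniteMeasure ℝ) :
    levyPhi b μ ∈ charFunctions := by
  have hfactor : levyPhi b μ = fun u : ℝ => Complex.exp (Complex.I * u * b) *
      Complex.exp (-((μ {0} : ℝ≥0) * u ^ 2 / 2)) *
        Complex.exp (∫ x in {0}ᶜ, levyKernel u x ∂(μ : Measure ℝ)) := by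
    ext u
    rw [levyPhi, integral_levyKernel_eq_add_setIntegral_compl, Complex.exp_add, Complex.exp_add,
      ← mul_assoc]
  rw [hfactor]
  refine mul_mem_charFunctions
    (mul_mem_charFunctions (exp_drift_mem_charFunctions b) (exp_gaussian_mem_charFunctions _)) ?_
  exact mem_charFunctions_of_tendsto
    (.of_forall fun n => exp_setIntegral_levyKernel_mem_charFunctions _ Nat.one_div_pos_of_nat)
    (continuous_integral_levyKernel _).cexp.continuousAt
    fun u => (tendsto_setIntegral_abs_gt (integrable_levyKernel u _)).cexp

lemma empiricalCharFun_mem_charFunctions {Ω : Type*} (X : ℝ≥0 → Ω → ℝ) {n : ℕ} (hn : n ≠ 0)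
    (ω : Ω) : empiricalCharFun X n ω ∈ charFunctions := by
  have hmean := convex_charFunctions.sum_mem (t := Finset.range n) (w := fun _ => (n : ℝ)⁻¹)
    (fun _ _ => by positivity) (by simp [hn])
    fun k _ => exp_drift_mem_charFunctions (X ((k : ℝ≥0) + 1) ω - X (k : ℝ≥0) ω)
  convert! hmean using 1
  ext u
  simp [empiricalCharFun, Finset.mul_sum]

/-! ### Convergence of integrals of characteristic functions -/

lemma norm_cexp_sub_cexp_le (u v x : ℝ) :
    ‖Complex.exp (Complex.I * u * x) - Complex.exp (Complex.I * v * x)‖ ≤ |u - v| * |x| := by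
  have hfactor : Complex.exp (Complex.I * u * x) - Complex.exp (Complex.I * v * x) =
      Complex.exp (Complex.I * v * x) *
        (Complex.exp (Complex.I * ((u - v) * x : ℝ)) - 1) := by
    rw [mul_sub, mul_one, ← Complex.exp_add]
    push_cast
    ring_nf
  rw [hfactor, norm_mul, norm_cexp_I_mul_mul, one_mul, ← abs_mul]
  exact Real.norm_exp_I_mul_ofReal_sub_one_le

lemma norm_charFun_sub_charFun_le (μ : Measure ℝ) [IsProbabilityMeasure μ] {K : ℝ} (hK : 0 ≤ K)
    (u v : ℝ) :
    ‖charFun μ u - charFun μ v‖ ≤ K * |u - v| + 2 * μ.real {x | K < |x|} := by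
  set S : Set ℝ := {x | K < |x|}
  have hS : MeasurableSet S := measurableSet_lt measurable_const continuous_abs.measurable
  have hind : Integrable (S.indicator fun _ => (2 : ℝ)) μ := (integrable_const 2).indicator hS
  have hpoint (x : ℝ) : ‖Complex.exp (Complex.I * u * x) - Complex.exp (Complex.I * v * x)‖ ≤
      K * |u - v| + S.indicator (fun _ => (2 : ℝ)) x := by
    by_cases hx : x ∈ S
    · have htwo := norm_sub_le (Complex.exp (Complex.I * u * x)) (Complex.exp (Complex.I * v * x))
      rw [norm_cexp_I_mul_mul, norm_cexp_I_mul_mul] at htwo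
      rw [Set.indicator_of_mem hx]
      linarith [mul_nonneg hK (abs_nonneg (u - v))]
    · rw [Set.indicator_of_notMem hx, add_zero, mul_comm K]
      exact (norm_cexp_sub_cexp_le u v x).trans
        (mul_le_mul_of_nonneg_left (not_lt.1 hx) (abs_nonneg _))
  rw [charFun_eq_integral_cexp, charFun_eq_integral_cexp,
    ← integral_sub (integrable_cexp_I_mul_mul u μ) (integrable_cexp_I_mul_mul v μ)]
  calc _ ≤ ∫ x, (K * |u - v| + S.indicator (fun _ => (2 : ℝ)) x) ∂μ :=
        norm_integral_le_of_norm_le ((integrable_const _).add hind) (.of_forall hpoint)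
    _ = K * |u - v| + 2 * μ.real S := by
        rw [integral_add (integrable_const _) hind, integral_indicator hS]
        simp [mul_comm]

lemma exists_integral_one_sub_lt {f : ℝ → ℂ} (hf : ContinuousAt f 0) (hf0 : f 0 = 1) {ε : ℝ}
    (hε : 0 < ε) : ∃ r > 0, 2⁻¹ * r * ‖∫ t in (-2 * r⁻¹)..(2 * r⁻¹), 1 - f t‖ < ε := by
  obtain ⟨δ, hδ, hfδ⟩ := Metric.continuousAt_iff.1 hf (ε / 4) (by positivity)
  refine ⟨4 / δ, by positivity, ?_⟩
  have hend : 2 * (4 / δ)⁻¹ = δ / 2 := by field_simp; norm_num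
  have hint : ‖∫ t in -(δ / 2)..(δ / 2), 1 - f t‖ ≤ ε / 4 * |δ / 2 - -(δ / 2)| := by
    refine intervalIntegral.norm_integral_le_of_norm_le_const fun t ht => ?_
    rw [Set.uIoc_of_le (by linarith)] at ht
    have htδ : dist t 0 < δ := by
      rw [Real.dist_0_eq_abs]; exact abs_lt.2 ⟨by linarith [ht.1], by linarith [ht.2]⟩
    rw [← hf0, ← dist_eq_norm, dist_comm]
    exact (hfδ htδ).le
  rw [sub_neg_eq_add, add_halves, abs_of_pos hδ] at hint
  rw [neg_mul, hend]
  calc 2⁻¹ * (4 / δ) * ‖∫ t in -(δ / 2)..(δ / 2), 1 - f t‖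
      ≤ 2⁻¹ * (4 / δ) * (ε / 4 * δ) := by gcongr
    _ = ε / 2 := by field_simp
    _ < ε := half_lt_self hε

lemma exists_eventually_measureReal_abs_gt_le {ι : Type*} {l : Filter ι} {μ : ι → Measure ℝ}
    [∀ i, IsProbabilityMeasure (μ i)] {f : ℝ → ℂ} (hf : Continuous f) (hf0 : f 0 = 1)
    (hint : ∀ s t : ℝ, Tendsto (fun i => ∫ u in s..t, charFun (μ i) u) l (𝓝 (∫ u in s..t, f u)))
    {ε : ℝ} (hε : 0 < ε) : ∃ r > 0, ∀ᶠ i in l, (μ i).real {x | r < |x|} ≤ ε := by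
  obtain ⟨r, hr, hfr⟩ := exists_integral_one_sub_lt hf.continuousAt hf0 hε
  have hlim : Tendsto (fun i => 2⁻¹ * r * ‖∫ t in (-2 * r⁻¹)..(2 * r⁻¹), 1 - charFun (μ i) t‖) l
      (𝓝 (2⁻¹ * r * ‖∫ t in (-2 * r⁻¹)..(2 * r⁻¹), 1 - f t‖)) := by
    have hsub {g : ℝ → ℂ} (hg : Continuous g) (a b : ℝ) :
        ∫ t in a..b, 1 - g t = (∫ _ in a..b, (1 : ℂ)) - ∫ t in a..b, g t :=
      intervalIntegral.integral_sub (by simp) (hg.intervalIntegrable _ _)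
    simp_rw [fun i => hsub (continuous_charFun (μ := μ i)), hsub hf]
    exact ((tendsto_const_nhds.sub (hint _ _)).norm).const_mul _
  refine ⟨r, hr, (hlim.eventually_lt_const hfr).mono fun i hi => ?_⟩
  exact (measureReal_abs_gt_le_integral_charFun hr).trans hi.le

lemma norm_sub_inv_smul_intervalIntegral_le {E : Type*} [NormedAddCommGroup E] [NormedSpace ℝ E]
    [CompleteSpace E] {f : ℝ → E} (hf : Continuous f) {a : E} {c δ ε : ℝ} (hδ : 0 < δ)
    (h : ∀ t ∈ Set.Ioc c (c + δ), ‖a - f t‖ ≤ ε) :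
    ‖a - δ⁻¹ • ∫ t in c..c + δ, f t‖ ≤ ε := by
  have hsub : a - δ⁻¹ • ∫ t in c..c + δ, f t = δ⁻¹ • ∫ t in c..c + δ, (a - f t) := by
    rw [intervalIntegral.integral_sub intervalIntegrable_const (hf.intervalIntegrable _ _),
      intervalIntegral.integral_const, add_sub_cancel_left, smul_sub, inv_smul_smul₀ hδ.ne']
  have hint : ‖∫ t in c..c + δ, (a - f t)‖ ≤ ε * |c + δ - c| :=
    intervalIntegral.norm_integral_le_of_norm_le_const fun t ht =>
      h t (by rwa [Set.uIoc_of_le (by linarith)] at ht)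
  rw [add_sub_cancel_left, abs_of_pos hδ] at hint
  rwa [hsub, norm_smul, norm_inv, Real.norm_of_nonneg hδ.le, inv_mul_le_iff₀ hδ, mul_comm]

lemma tendstoLocallyUniformly_of_tendsto_intervalIntegral {ι E : Type*} [NormedAddCommGroup E]
    [NormedSpace ℝ E] [CompleteSpace E] {l : Filter ι} {F : ι → ℝ → E} {f : ℝ → E}
    (hF : ∀ i, Continuous (F i)) (hf : Continuous f)
    (hequi : ∀ ε > 0, ∃ δ > 0, ∀ᶠ i in l, ∀ u v : ℝ, |u - v| ≤ δ → ‖F i u - F i v‖ ≤ ε)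
    (hint : ∀ s t : ℝ, Tendsto (fun i => ∫ u in s..t, F i u) l (𝓝 (∫ u in s..t, f u))) :
    TendstoLocallyUniformly F f l := by
  rw [Metric.tendstoLocallyUniformly_iff]
  intro ε hε c
  obtain ⟨η, hη, hFη⟩ := hequi (ε / 4) (by positivity)
  obtain ⟨ρ, hρ, hfρ⟩ := Metric.continuous_iff.1 hf c (ε / 8) (by positivity)
  obtain ⟨δ, hδ, hδmin⟩ := exists_between (show 0 < min (η / 2) ρ by positivity)
  obtain ⟨hδη, hδρ⟩ := lt_min_iff.1 hδmin
  have hball {v t : ℝ} (hv : dist v c < δ) (ht : t ∈ Set.Ioc c (c + δ)) :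
      dist t c ≤ δ ∧ |v - t| ≤ η := by
    rw [Real.dist_eq, abs_lt] at hv
    rw [Real.dist_eq]
    exact ⟨abs_le.2 ⟨by linarith [ht.1], by linarith [ht.2]⟩,
      abs_le.2 ⟨by linarith [ht.2], by linarith [ht.1]⟩⟩
  have hfball {v t : ℝ} (hv : dist v c < δ) (ht : t ∈ Set.Ioc c (c + δ)) :
      ‖f v - f t‖ ≤ ε / 4 := by
    rw [← dist_eq_norm]
    linarith [dist_triangle_right (f v) (f t) (f c), hfρ v (hv.trans hδρ),
      hfρ t ((hball hv ht).1.trans_lt hδρ)]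
  have havg := Metric.tendsto_nhds.1 ((hint c (c + δ)).const_smul δ⁻¹) (ε / 4) (by positivity)
  refine ⟨Metric.ball c δ, Metric.ball_mem_nhds c hδ, ?_⟩
  filter_upwards [hFη, havg] with i hFi havg v hv
  have hfv := norm_sub_inv_smul_intervalIntegral_le hf hδ fun t ht => hfball hv ht
  have hFv := norm_sub_inv_smul_intervalIntegral_le (hF i) hδ
    fun t ht => hFi v t (hball hv ht).2
  rw [← dist_eq_norm] at hfv hFv
  linarith [dist_triangle4_right (f v) (F i v) (δ⁻¹ • ∫ t in c..c + δ, f t)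
    (δ⁻¹ • ∫ t in c..c + δ, F i t), dist_comm (δ⁻¹ • ∫ t in c..c + δ, F i t)
    (δ⁻¹ • ∫ t in c..c + δ, f t)]

lemma tendstoLocallyUniformly_charFun_of_tendsto_intervalIntegral {ι : Type*} {l : Filter ι}
    {μ : ι → Measure ℝ} [∀ i, IsProbabilityMeasure (μ i)] {f : ℝ → ℂ} (hf : Continuous f)
    (hf0 : f 0 = 1)
    (hint : ∀ s t : ℝ, Tendsto (fun i => ∫ u in s..t, charFun (μ i) u) l
      (𝓝 (∫ u in s..t, f u))) :
    TendstoLocallyUniformly (fun i => charFun (μ i)) f l := by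
  refine tendstoLocallyUniformly_of_tendsto_intervalIntegral (fun i => continuous_charFun) hf
    (fun ε hε => ?_) hint
  obtain ⟨K, hK, htail⟩ :=
    exists_eventually_measureReal_abs_gt_le hf hf0 hint (ε := ε / 4) (by positivity)
  refine ⟨ε / 2 / K, by positivity, htail.mono fun i hi u v huv => ?_⟩
  have hKuv : K * |u - v| ≤ ε / 2 := by rwa [mul_comm, ← le_div_iff₀ hK]
  linarith [norm_charFun_sub_charFun_le (μ i) hK.le u v]

/-! ### Convergence of continuous logarithms -/

lemma clog_cexp_eqOn {X : Type*} [TopologicalSpace X] {S : Set X} (hS : IsPreconnected S)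
    {θ : X → ℂ} (hθ : ContinuousOn θ S) (hslit : ∀ x ∈ S, Complex.exp (θ x) ∈ Complex.slitPlane)
    {x₀ : X} (hx₀ : x₀ ∈ S) (hθx₀ : θ x₀ = 0) :
    Set.EqOn (fun x => Complex.log (Complex.exp (θ x))) θ S := by
  -- By connectedness the imaginary part of `θ` cannot cross `±π`, where `exp θ` would be negative.
  have him : ∀ x ∈ S, |(θ x).im| < Real.pi := by
    by_contra! hcon
    obtain ⟨x, hx, hpi⟩ := hcon
    have hcont : ContinuousOn (fun x => |(θ x).im|) S :=
      (Complex.continuous_im.comp_continuousOn hθ).abs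
    obtain ⟨y, hy, hypi : |(θ y).im| = Real.pi⟩ :=
      hS.intermediate_value hx₀ hx hcont ⟨by simp [hθx₀, Real.pi_pos.le], hpi⟩
    have hsin : Real.sin (θ y).im = 0 := by
      rcases abs_choice (θ y).im with h | h <;> rw [h] at hypi
      · rw [hypi, Real.sin_pi]
      · rw [← neg_neg (θ y).im, hypi, Real.sin_neg, Real.sin_pi, neg_zero]
    have hcos : Real.cos (θ y).im = -1 := by rw [← Real.cos_abs, hypi, Real.cos_pi]
    rcases hslit y hy with h | h
    · rw [Complex.exp_re, hcos] at h
      linarith [Real.exp_pos (θ y).re]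
    · exact h (by rw [Complex.exp_im, hsin, mul_zero])
  exact fun x hx => Complex.log_exp (abs_lt.1 (him x hx)).1 (abs_lt.1 (him x hx)).2.le

lemma tendstoUniformlyOn_cexp_sub {ι X : Type*} [TopologicalSpace X] {l : Filter ι} {K : Set X}
    (hK : IsCompact K) {ψ : ι → X → ℂ} {ψ₀ : X → ℂ} (hψ₀ : ContinuousOn ψ₀ K)
    (h : TendstoUniformlyOn (fun i x => Complex.exp (ψ i x)) (fun x => Complex.exp (ψ₀ x)) l K) :
    TendstoUniformlyOn (fun i x => Complex.exp (ψ i x - ψ₀ x)) (fun _ => 1) l K := by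
  have hconst : TendstoUniformlyOn (fun (_ : ι) x => Complex.exp (-ψ₀ x))
      (fun x => Complex.exp (-ψ₀ x)) l K := by
    rw [Metric.tendstoUniformlyOn_iff]
    exact fun ε hε => .of_forall fun _ x _ => by rwa [dist_self]
  have hmul := h.tendstoLocallyUniformlyOn.mul₀ hconst.tendstoLocallyUniformlyOn hψ₀.cexp
    hψ₀.neg.cexp
  convert! (tendstoLocallyUniformlyOn_iff_tendstoUniformlyOn_of_compact hK).1 hmul using 1
  · ext i x; simp [sub_eq_add_neg, Complex.exp_add]
  · ext x; simp [← Complex.exp_add]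

lemma tendstoUniformlyOn_of_cexp {ι X : Type*} [TopologicalSpace X] {l : Filter ι} {K : Set X}
    (hK : IsCompact K) (hK' : IsPreconnected K) {x₀ : X} (hx₀ : x₀ ∈ K) {ψ : ι → X → ℂ}
    {ψ₀ : X → ℂ} (hψ : ∀ i, ContinuousOn (ψ i) K) (hψ₀ : ContinuousOn ψ₀ K)
    (hx₀ψ : ∀ i, ψ i x₀ = ψ₀ x₀)
    (h : TendstoUniformlyOn (fun i x => Complex.exp (ψ i x)) (fun x => Complex.exp (ψ₀ x)) l K) :
    TendstoUniformlyOn ψ ψ₀ l K := by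
  rw [Metric.tendstoUniformlyOn_iff]
  intro ε hε
  have hlog : ∀ᶠ z in 𝓝 (1 : ℂ), z ∈ Complex.slitPlane ∧ ‖Complex.log z‖ < ε := by
    have hlim := (continuousAt_clog Complex.one_mem_slitPlane).norm
    rw [ContinuousAt, Complex.log_one, norm_zero] at hlim
    exact (Complex.isOpen_slitPlane.eventually_mem Complex.one_mem_slitPlane).and
      (hlim.eventually_lt_const hε)
  obtain ⟨δ, hδ, hball⟩ := Metric.eventually_nhds_iff.1 hlog
  filter_upwards [Metric.tendstoUniformlyOn_iff.1 (tendstoUniformlyOn_cexp_sub hK hψ₀ h) δ hδ]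
    with i hi x hx
  have hclose {y : X} (hy : y ∈ K) := hball ((dist_comm _ _).trans_lt (hi y hy))
  have hlift : Complex.log (Complex.exp (ψ i x - ψ₀ x)) = ψ i x - ψ₀ x :=
    clog_cexp_eqOn hK' ((hψ i).sub hψ₀) (fun y hy => (hclose hy).1) hx₀
      (sub_eq_zero.2 (hx₀ψ i)) hx
  rw [dist_comm, dist_eq_norm, ← hlift]
  exact (hclose hx).2

/-! ### Convergence of the characteristics -/

lemma tendsto_mass_of_tendsto_charFun {ι : Type*} {l : Filter ι} {μ : ι → FiniteMeasure ℝ}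
    {μ₀ : FiniteMeasure ℝ}
    (h : Tendsto (fun i => charFun (μ i : Measure ℝ) 0) l (𝓝 (charFun (μ₀ : Measure ℝ) 0))) :
    Tendsto (fun i => (μ i).mass) l (𝓝 μ₀.mass) := by
  simp only [charFun_zero] at h
  exact NNReal.tendsto_coe.1 (tendsto_ofReal_iff.1 h)

lemma charFun_normalize {μ : FiniteMeasure ℝ} (hμ : μ ≠ 0) (u : ℝ) :
    charFun (μ.normalize : Measure ℝ) u = (μ.mass : ℂ)⁻¹ * charFun (μ : Measure ℝ) u := by
  rw [μ.toMeasure_normalize_eq_of_nonzero hμ, charFun_apply, charFun_apply,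
    integral_smul_nnreal_measure, NNReal.smul_def, Complex.real_smul]
  push_cast
  rfl

lemma finiteMeasure_tendsto_of_tendsto_charFun {μ : ℕ → FiniteMeasure ℝ} {μ₀ : FiniteMeasure ℝ}
    (h : ∀ u : ℝ, Tendsto (fun n => charFun (μ n : Measure ℝ) u) atTop
      (𝓝 (charFun (μ₀ : Measure ℝ) u))) :
    Tendsto μ atTop (𝓝 μ₀) := by
  have hmass := tendsto_mass_of_tendsto_charFun (h 0)
  rcases eq_or_ne μ₀ 0 with rfl | h0
  · exact FiniteMeasure.tendsto_zero_of_tendsto_zero_mass (by simpa using hmass)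
  have hmass0 : μ₀.mass ≠ 0 := μ₀.mass_nonzero_iff.2 h0
  refine FiniteMeasure.tendsto_of_tendsto_normalize_testAgainstNN_of_tendsto_mass
    (ProbabilityMeasure.tendsto_of_tendsto_charFun fun u => ?_) hmass
  have hmassinv : Tendsto (fun n => ((μ n).mass : ℂ)⁻¹) atTop (𝓝 (μ₀.mass : ℂ)⁻¹) :=
    (tendsto_ofReal_iff.2 (NNReal.tendsto_coe.2 hmass)).inv₀ (by exact_mod_cast hmass0)
  rw [charFun_normalize h0]
  refine (hmassinv.mul (h u)).congr' ?_
  filter_upwards [hmass.eventually_ne hmass0] with n hn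
  rw [charFun_normalize ((μ n).mass_nonzero_iff.1 hn)]

/-- The finite measure `w μ`, where `w` is `levyWeight`. Its characteristic function is the exponent
of `levyPhi b μ` minus its average over `[u - 1, u + 1]`. -/
noncomputable def levyWeighted (μ : FiniteMeasure ℝ) : FiniteMeasure ℝ :=
  ⟨(μ : Measure ℝ).withDensity fun x => ENNReal.ofReal (levyWeight x),
    isFiniteMeasure_withDensity_ofReal
      (Integrable.of_bound continuous_levyWeight.aestronglyMeasurable 3 (.of_forall fun x =>
        (Real.norm_of_nonneg (levyWeight_pos x).le).trans_le (levyWeight_le x))).2⟩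

lemma integral_levyWeighted {E : Type*} [NormedAddCommGroup E] [NormedSpace ℝ E]
    (μ : FiniteMeasure ℝ) (f : ℝ → E) :
    ∫ x, f x ∂(levyWeighted μ : Measure ℝ) = ∫ x, levyWeight x • f x ∂(μ : Measure ℝ) := by
  refine (integral_withDensity_eq_integral_toReal_smul
    continuous_levyWeight.measurable.ennreal_ofReal (by simp) f).trans ?_
  simp_rw [fun x => ENNReal.toReal_ofReal (levyWeight_pos x).le]

lemma charFun_levyWeighted (b : ℝ) (μ : FiniteMeasure ℝ) (u : ℝ) :
    charFun (levyWeighted μ : Measure ℝ) u =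
      levyExponent b μ u - (1 / 2) * ∫ s in (-1 : ℝ)..1, levyExponent b μ (u + s) := by
  rw [levyExponent_sub_average, charFun_eq_integral_cexp, integral_levyWeighted]
  simp_rw [Complex.real_smul, mul_comm]

lemma tendsto_of_tendsto_levyWeighted {ι : Type*} {l : Filter ι} {μ : ι → FiniteMeasure ℝ}
    {μ₀ : FiniteMeasure ℝ} (h : Tendsto (fun i => levyWeighted (μ i)) l (𝓝 (levyWeighted μ₀))) :
    Tendsto μ l (𝓝 μ₀) := by
  rw [FiniteMeasure.tendsto_iff_forall_integral_tendsto] at h ⊢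
  intro f
  obtain ⟨c, hc, hcw⟩ := exists_pos_le_levyWeight
  let g : BoundedContinuousFunction ℝ ℝ := .ofNormedAddCommGroup
    (fun x => (levyWeight x)⁻¹ * f x)
    ((continuous_levyWeight.inv₀ fun x => (levyWeight_pos x).ne').mul f.continuous)
    (c⁻¹ * ‖f‖) fun x => by
      rw [norm_mul, norm_inv, Real.norm_of_nonneg (levyWeight_pos x).le]
      gcongr
      exacts [hcw x, f.norm_coe_le_norm x]
  have hg (m : FiniteMeasure ℝ) :
      ∫ x, g x ∂(levyWeighted m : Measure ℝ) = ∫ x, f x ∂(m : Measure ℝ) := by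
    rw [integral_levyWeighted]
    congr 1 with x
    exact mul_inv_cancel_left₀ (levyWeight_pos x).ne' (f x)
  simpa only [hg] using h g

lemma tendsto_levyMeasure_of_tendsto_levyExponent {b : ℕ → ℝ} {μ : ℕ → FiniteMeasure ℝ} {b₀ : ℝ}
    {μ₀ : FiniteMeasure ℝ}
    (h : TendstoLocallyUniformly (fun n => levyExponent (b n) (μ n)) (levyExponent b₀ μ₀) atTop) :
    Tendsto μ atTop (𝓝 μ₀) := by
  refine tendsto_of_tendsto_levyWeighted (finiteMeasure_tendsto_of_tendsto_charFun fun u => ?_)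
  simp_rw [charFun_levyWeighted b₀ μ₀, fun n => charFun_levyWeighted (b n) (μ n)]
  have hshift : TendstoUniformlyOn (fun n s => levyExponent (b n) (μ n) (u + s))
      (fun s => levyExponent b₀ μ₀ (u + s)) atTop (Set.uIcc (-1) 1) :=
    (tendstoLocallyUniformlyOn_iff_tendstoUniformlyOn_of_compact isCompact_uIcc).1
      (h.comp (u + ·) (continuous_const_add u)).tendstoLocallyUniformlyOn
  refine ((tendstoLocallyUniformlyOn_univ.2 h).tendsto_at (Set.mem_univ u)).sub (.const_mul _ ?_)
  exact hshift.tendsto_intervalIntegral_of_continuousOn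
    (.of_forall fun n => ((continuous_levyExponent _ _).comp (continuous_const_add u)).continuousOn)

lemma tendsto_drift_of_tendsto_levyExponent {ι : Type*} {l : Filter ι} {b : ι → ℝ}
    {μ : ι → FiniteMeasure ℝ} {b₀ : ℝ} {μ₀ : FiniteMeasure ℝ} (hμ : Tendsto μ l (𝓝 μ₀))
    (h : Tendsto (fun i => levyExponent (b i) (μ i) 1) l (𝓝 (levyExponent b₀ μ₀ 1))) :
    Tendsto b l (𝓝 b₀) := by
  let k : BoundedContinuousFunction ℝ ℂ := .ofNormedAddCommGroup (levyKernel 1)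
    (continuous_levyKernel_right 1) _ (norm_levyKernel_le 1)
  have hdrift (b' : ℝ) (m : FiniteMeasure ℝ) :
      (levyExponent b' m 1 - ∫ x, k x ∂(m : Measure ℝ)).im = b' := by
    have hk : ∫ x, k x ∂(m : Measure ℝ) = ∫ x, levyKernel 1 x ∂(m : Measure ℝ) := rfl
    rw [levyExponent, hk, add_sub_cancel_right]
    simp
  have hint := (FiniteMeasure.tendsto_iff_forall_integral_rclike_tendsto ℂ).1 hμ k
  simpa only [Function.comp_def, hdrift] using
    (Complex.continuous_im.tendsto _).comp (h.sub hint)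

lemma tendstoLocallyUniformly_levyExponent {ι : Type*} {l : Filter ι} {b : ι → ℝ}
    {μ : ι → FiniteMeasure ℝ} {b₀ : ℝ} {μ₀ : FiniteMeasure ℝ}
    (h : TendstoLocallyUniformly (fun i => levyPhi (b i) (μ i)) (levyPhi b₀ μ₀) l) :
    TendstoLocallyUniformly (fun i => levyExponent (b i) (μ i)) (levyExponent b₀ μ₀) l := by
  rw [tendstoLocallyUniformly_iff_forall_isCompact]
  intro K hK
  obtain ⟨T, hT, hKT⟩ := hK.isBounded.subset_closedBall_lt 0 0
  refine (tendstoUniformlyOn_of_cexp (isCompact_closedBall 0 T)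
    (convex_closedBall 0 T).isPreconnected (Metric.mem_closedBall_self hT.le)
    (fun i => (continuous_levyExponent _ _).continuousOn)
    (continuous_levyExponent _ _).continuousOn
    (fun i => by rw [levyExponent_zero, levyExponent_zero]) ?_).mono hKT
  exact tendstoLocallyUniformly_iff_forall_isCompact.1 h _ (isCompact_closedBall 0 T)

theorem tendsto_of_tendsto_intervalIntegral_levyPhi {b : ℕ → ℝ} {μ : ℕ → FiniteMeasure ℝ}
    {b₀ : ℝ} {μ₀ : FiniteMeasure ℝ}
    (h : ∀ s t : ℝ, Tendsto (fun n => ∫ u in s..t, levyPhi (b n) (μ n) u) atTop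
      (𝓝 (∫ u in s..t, levyPhi b₀ μ₀ u))) :
    Tendsto b atTop (𝓝 b₀) ∧ Tendsto μ atTop (𝓝 μ₀) := by
  choose Q _ hQ using fun n => levyPhi_mem_charFunctions (b n) (μ n)
  have hphi : TendstoLocallyUniformly (fun n => levyPhi (b n) (μ n)) (levyPhi b₀ μ₀) atTop := by
    simp_rw [hQ] at h ⊢
    exact tendstoLocallyUniformly_charFun_of_tendsto_intervalIntegral
      (continuous_levyExponent b₀ μ₀).cexp
      (congrArg Complex.exp (levyExponent_zero b₀ μ₀) |>.trans Complex.exp_zero) h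
  have hexponent := tendstoLocallyUniformly_levyExponent hphi
  have hμ := tendsto_levyMeasure_of_tendsto_levyExponent hexponent
  exact ⟨tendsto_drift_of_tendsto_levyExponent hμ
    ((tendstoLocallyUniformlyOn_univ.2 hexponent).tendsto_at (Set.mem_univ 1)), hμ⟩

/-! ### Minimum distance estimation -/

lemma IsDistanceOn.tendsto_of_le_iInf_add {α Θ ι : Type*} {S : Set α} {d : α → α → ℝ≥0∞}
    (hd : IsDistanceOn S d) {φ : Θ → α} (hφ : ∀ θ, φ θ ∈ S) {l : Filter ι} {x : ι → α}
    (hx : ∀ᶠ i in l, x i ∈ S) {θ₀ : Θ} (hxθ₀ : Tendsto (fun i => d (x i) (φ θ₀)) l (𝓝 0))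
    {δ : ι → ℝ≥0∞} (hδ : Tendsto δ l (𝓝 0)) {θ : ι → Θ}
    (hfit : ∀ᶠ i in l, d (x i) (φ (θ i)) ≤ (⨅ θ', d (x i) (φ θ')) + δ i) :
    Tendsto (fun i => d (φ (θ i)) (φ θ₀)) l (𝓝 0) := by
  have hlim : Tendsto (fun i => d (x i) (φ θ₀) + δ i + d (x i) (φ θ₀)) l (𝓝 0) := by
    simpa using (hxθ₀.add hδ).add hxθ₀
  refine tendsto_of_tendsto_of_tendsto_of_le_of_le' tendsto_const_nhds hlim
    (.of_forall fun _ => zero_le) ?_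
  filter_upwards [hx, hfit] with i hxi hfiti
  calc d (φ (θ i)) (φ θ₀) ≤ d (φ (θ i)) (x i) + d (x i) (φ θ₀) :=
        hd.triangle _ (hφ _) _ hxi _ (hφ _)
    _ = d (x i) (φ (θ i)) + d (x i) (φ θ₀) := by rw [hd.symm _ (hφ _) _ hxi]
    _ ≤ d (x i) (φ θ₀) + δ i + d (x i) (φ θ₀) := by
        gcongr; exact hfiti.trans (by gcongr; exact iInf_le _ θ₀)

theorem theorem3p1_general {Ω : Type*} [MeasurableSpace Ω] (P : Measure Ω)
    (φHat : ℕ → Ω → ℝ → ℂ) (hφHat : ∀ n, 1 ≤ n → ∀ ω, φHat n ω ∈ charFunctions)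
    (b₀ : ℝ) (μ₀ : FiniteMeasure ℝ)
    (d : (ℝ → ℂ) → (ℝ → ℂ) → ℝ≥0∞) (hd : IsDistanceOn charFunctions d)
    (hd_emp : ∀ᵐ ω ∂P, Tendsto (fun n => d (φHat n ω) (levyPhi b₀ μ₀)) atTop (𝓝 0))
    (hd_int : ∀ (b' : ℕ → ℝ) (μ' : ℕ → FiniteMeasure ℝ),
      Tendsto (fun n => d (levyPhi (b' n) (μ' n)) (levyPhi b₀ μ₀)) atTop (𝓝 0) →
      ∀ s t : ℝ, Tendsto (fun n => ∫ u in s..t, levyPhi (b' n) (μ' n) u) atTop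
        (𝓝 (∫ u in s..t, levyPhi b₀ μ₀ u)))
    (δ : ℕ → ℝ) (hδ : Tendsto δ atTop (𝓝 0))
    (bHat : ℕ → Ω → ℝ) (muHat : ℕ → Ω → FiniteMeasure ℝ)
    (hfit : ∀ᵐ ω ∂P, ∀ n : ℕ, 1 ≤ n → d (φHat n ω) (levyPhi (bHat n ω) (muHat n ω)) ≤
      (⨅ (b' : ℝ) (μ' : FiniteMeasure ℝ), d (φHat n ω) (levyPhi b' μ')) + ENNReal.ofReal (δ n)) :
    ∀ᵐ ω ∂P, Tendsto (fun n => bHat n ω) atTop (𝓝 b₀) ∧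
      Tendsto (fun n => muHat n ω) atTop (𝓝 μ₀) := by
  have hδ' : Tendsto (fun n => ENNReal.ofReal (δ n)) atTop (𝓝 0) := by
    simpa using ENNReal.tendsto_ofReal hδ
  filter_upwards [hd_emp, hfit] with ω hemp hω
  refine tendsto_of_tendsto_intervalIntegral_levyPhi (hd_int _ _ ?_)
  exact hd.tendsto_of_le_iInf_add (φ := fun p : ℝ × FiniteMeasure ℝ => levyPhi p.1 p.2)
    (θ₀ := (b₀, μ₀)) (θ := fun n => (bHat n ω, muHat n ω))
    (fun p => levyPhi_mem_charFunctions p.1 p.2)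
    ((eventually_ge_atTop 1).mono fun n hn => hφHat n hn ω) hemp hδ'
    ((eventually_ge_atTop 1).mono fun n hn => by rw [iInf_prod]; exact hω n hn)

theorem theorem3p1 {Ω : Type*} [MeasurableSpace Ω] (P : Measure Ω) [IsProbabilityMeasure P]
    -- the observed Lévy process and its true characteristics
    (X : ℝ≥0 → Ω → ℝ) (hX : IsLevyProcess P X)
    (b σ : ℝ) (hσ : 0 ≤ σ) (ν : Measure ℝ) (hν : IsJumpMeasure ν)
    (hT : HasTriplet P X b σ ν)
    -- the distance
    (d : (ℝ → ℂ) → (ℝ → ℂ) → ℝ≥0∞) (hd : IsDistanceOn charFunctions d)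
    -- consistency of the empirical characteristic function in `d`
    (hd_emp : ∀ᵐ ω ∂P, Tendsto
      (fun n : ℕ => d (empiricalCharFun X n ω) (levyPhi b (nuSigma σ ν hν))) atTop (𝓝 0))
    -- convergence in `d` implies convergence of the integrals over intervals
    (hd_int : ∀ (b' : ℕ → ℝ) (μ' : ℕ → FiniteMeasure ℝ),
      Tendsto (fun n => d (levyPhi (b' n) (μ' n)) (levyPhi b (nuSigma σ ν hν))) atTop (𝓝 0) →
      ∀ s t : ℝ, Tendsto (fun n => ∫ u in s..t, levyPhi (b' n) (μ' n) u) atTop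
        (𝓝 (∫ u in s..t, levyPhi b (nuSigma σ ν hν) u)))
    -- the approximate minimum distance fit
    (δ : ℕ → ℝ) (hδ_pos : ∀ n, 1 ≤ n → 0 < δ n) (hδ : Tendsto δ atTop (𝓝 0))
    (bHat : ℕ → Ω → ℝ) (nuHat : ℕ → Ω → FiniteMeasure ℝ)
    (hfit : ∀ᵐ ω ∂P, ∀ n : ℕ, 1 ≤ n →
      d (empiricalCharFun X n ω) (levyPhi (bHat n ω) (nuHat n ω)) ≤
        (⨅ (b' : ℝ) (μ' : FiniteMeasure ℝ), d (empiricalCharFun X n ω) (levyPhi b' μ')) +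
          ENNReal.ofReal (δ n)) :
    ∀ᵐ ω ∂P, Tendsto (fun n => bHat n ω) atTop (𝓝 b) ∧
      Tendsto (fun n => nuHat n ω) atTop (𝓝 (nuSigma σ ν hν)) :=
  theorem3p1_general P (empiricalCharFun X)
    (fun _ hn ω => empiricalCharFun_mem_charFunctions X (Nat.one_le_iff_ne_zero.1 hn) ω)
    b (nuSigma σ ν hν) d hd hd_emp hd_int δ hδ bHat nuHat hfit
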